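/- Let $\mathcal Z$ be a nonempty countable set with the discrete $\sigma$-algebra and a fixed injective numbering by natural numbers. A probability distribution $P$ on $\mathcal Z^{\mathbb N}$ is called computable if there is a program that, given a finite word $x=(x_1,\dots,x_n)$ over $\mathcal Z$ and $k\in\mathbb N$, halts and outputs an integer $m\ge 0$ with $|m2^{-k}-P(Z_1=x_1,\dots,Z_n=x_n)|\le 2^{-k}$; here $Z_1,Z_2,\dots$ are the coordinates of the sequence. Let $\Theta$ be the (countable) set of all programs $\theta$ that compute a probability distribution, denoted $P_\theta$, in this sense. A prediction problem consists of a measurable space $\mathcal B$ of predictions and a measurable loss $\ell:\mathcal B\times\mathcal Z\to[0,L]$. A policy is a sequence of measurable maps $b_t:\mathcal Z^{t-1}\to\mathcal B$, $t\ge1$. For a probability distribution $R$ on $\mathcal Z^{\mathbb N}$, a policy is called $R$-optimal if for all $t$ and all $x\in\mathcal Z^{t-1}$ with $R((Z_1,\dots,Z_{t-1})=x)>0$, the prediction $b_t(x)$ minimizes $a\mapsto\mathbb E_R[\ell(a,Z_t)\mid (Z_1,\dots,Z_{t-1})=x]$ over $a\in\mathcal B$. The average regret of a policy $b$ against a policy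 $b^*$ after $T$ rounds is $$\Delta=\frac1T\sum_{t=1}^T\Big(\ell\big(b_t(Z_1,\dots,Z_{t-1}),Z_t\big)-\ell\big(b^*_t(Z_1,\dots,Z_{t-1}),Z_t\big)\Big).$$ Theorem. There are probability weights $w$ on $\Theta$ with $w(\theta)>0$ for all $\theta\in\Theta$. For each such $w$, let $Q=\sum_{\theta\in\Theta}w(\theta)P_\theta$ be the Bayes mixture, which is a probability distribution on $\mathcal Z^{\mathbb N}$. Then for every prediction problem: 1. If, for every $t$ and every history $x\in\mathcal Z^{t-1}$ with $Q((Z_1,\dots,Z_{t-1})=x)>0$, the minimum of $a\mapsto\mathbb E_Q[\ell(a,Z_t)\mid (Z_1,\dots,Z_{t-1})=x]$ over $\mathcal B$ is attained, then there is a $Q$-optimal policy. 2. Every $Q$-optimal policy $b$ (which does not depend on $P$, $T$ or $\delta$) is universal for all computable distributions: for every computable $P$ there is a constant $C$, depending only on $\mathcal Z$ with its numbering, $w$, $P$ and $L$, such that for every $P$-optimal policy $b^*$, every $T\ge1$ and every $\delta\in(0,1)$, $$P\left(\Delta<\frac{C}{\sqrt{T\delta}}\right)\ge 1-\delta .$$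 -/

import Mathlib

open MeasureTheory ProbabilityTheory

universe u v

namespace UniversalPrediction

/-- The event that the first `n` outcomes of the sequence are `x 0, …, x (n - 1)`.
Time is indexed from `0`, so the `t`-th outcome of a sequence `ω` is `ω (t - 1)`. -/
def cylinder {Z : Type u} {n : ℕ} (x : Fin n → Z) : Set (ℕ → Z) :=
  {ω | ∀ i : Fin n, ω i = x i}

/-- The program `c` (a code for a partial recursive function) computes the distribution `P` to
arbitrary precision: on input of (the number coding) a finite word `x` and a precision `k`, it halts
and outputs a natural number `m` such that `m / 2 ^ k` is within `2 ^ (-k)` of the probability that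
the sequence starts with `x`. Nothing is required on inputs that are not of this form. -/
def Computes {Z : Type u} [Encodable Z] [MeasurableSpace Z]
    (c : Nat.Partrec.Code) (P : Measure (ℕ → Z)) : Prop :=
  ∀ (n : ℕ) (x : Fin n → Z) (k : ℕ),
    ∃ m ∈ c.eval (Encodable.encode (List.ofFn x, k)),
      |(m : ℝ) / 2 ^ k - P.real (cylinder x)| ≤ 1 / 2 ^ k

/-- A distribution of sequences is computable if some program computes it to arbitrary precision. -/
def IsComputable {Z : Type u} [Encodable Z] [MeasurableSpace Z] (P : Measure (ℕ → Z)) : Prop :=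
  ∃ c : Nat.Partrec.Code, Computes c P

/-- The set of all programs that compute a probability distribution on `Z ^ ℕ`. -/
def Program (Z : Type u) [Encodable Z] [MeasurableSpace Z] : Type :=
  {c : Nat.Partrec.Code // ∃ P : Measure (ℕ → Z), IsProbabilityMeasure P ∧ Computes c P}

/-- The distribution computed by a program (it is unique, see `Program.law_eq`). -/
noncomputable def Program.law {Z : Type u} [Encodable Z] [MeasurableSpace Z] (θ : Program Z) :
    Measure (ℕ → Z) :=
  θ.2.choose

/-- A program computes at most one probability distribution. -/
theorem Program.law_eq {Z : Type u} [Encodable Z] [MeasurableSpace Z] [DiscreteMeasurableSpace Z]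
    (θ : Program Z) (P : Measure (ℕ → Z)) [IsProbabilityMeasure P] (h : Computes θ.1 P) :
    θ.law = P := by
  have hl : IsProbabilityMeasure θ.law := θ.2.choose_spec.1
  have hc : Computes θ.1 θ.law := θ.2.choose_spec.2
  have hcyl : ∀ (n : ℕ) (x : Fin n → Z), θ.law (cylinder x) = P (cylinder x) := by
    intro n x
    have key : ∀ k : ℕ, |θ.law.real (cylinder x) - P.real (cylinder x)| ≤ 2 * (1 / 2 : ℝ) ^ k := by
      intro k
      obtain ⟨m, hm, h1⟩ := hc n x k
      obtain ⟨m', hm', h2⟩ := h n x k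
      obtain rfl := Part.mem_unique hm hm'
      rw [one_div_pow]
      rw [abs_le] at *
      constructor <;> linarith [h1.1, h1.2, h2.1, h2.2]
    have lim : Filter.Tendsto (fun k : ℕ => 2 * (1 / 2 : ℝ) ^ k) Filter.atTop (nhds 0) := by
      simpa using (tendsto_pow_atTop_nhds_zero_of_lt_one (r := (1 / 2 : ℝ))
        (by norm_num) (by norm_num)).const_mul 2
    have h0 := ge_of_tendsto' lim key
    have h1 : θ.law.real (cylinder x) = P.real (cylinder x) :=
      sub_eq_zero.1 (abs_eq_zero.1 (le_antisymm h0 (abs_nonneg _)))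
    exact (measureReal_eq_measureReal_iff).1 h1
  have hfin : ∀ n : ℕ, θ.law.map (fun ω (i : Fin n) => ω i) = P.map (fun ω (i : Fin n) => ω i) := by
    intro n
    have hm : Measurable (fun (ω : ℕ → Z) (i : Fin n) => ω i) := by fun_prop
    refine Measure.ext_of_singleton fun x => ?_
    rw [Measure.map_apply hm (measurableSet_singleton x),
      Measure.map_apply hm (measurableSet_singleton x)]
    have : (fun (ω : ℕ → Z) (i : Fin n) => ω i) ⁻¹' {x} = cylinder x := by
      ext ω
      simp [cylinder, funext_iff]
    rw [this, hcyl]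
  have hP : IsProjectiveLimit P
      (fun I : Finset ℕ => P.map (fun ω (i : I) => ω i)) := fun I => rfl
  refine IsProjectiveLimit.unique (P := fun I : Finset ℕ => P.map (fun ω (i : I) => ω i)) ?_ hP
  intro I
  let n := I.sup id + 1
  let g : (Fin n → Z) → (I → Z) := fun y i =>
    y ⟨i, Nat.lt_succ_of_le (Finset.le_sup (f := id) i.2)⟩
  have hg : Measurable g := by fun_prop
  have hm : Measurable (fun (ω : ℕ → Z) (i : Fin n) => ω i) := by fun_prop
  have e := congrArg (Measure.map g) (hfin n)
  rw [Measure.map_map hg hm, Measure.map_map hg hm] at e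
  exact e

/-- The Bayes mixture `∑ θ, w θ • P_θ` of the computable distributions under the prior `w`. -/
noncomputable def mixture {Z : Type u} [Encodable Z] [MeasurableSpace Z]
    (w : PMF (Program Z)) : Measure (ℕ → Z) :=
  Measure.sum fun θ => w θ • θ.law

/-- A measurable loss function with values in `[0, L]`. -/
structure IsLoss {Z : Type u} {B : Type v} [MeasurableSpace Z] [MeasurableSpace B]
    (L : ℝ) (ℓ : B → Z → ℝ) : Prop where
  measurable : Measurable (Function.uncurry ℓ)
  nonneg : ∀ a z, 0 ≤ ℓ a z
  le : ∀ a z, ℓ a z ≤ L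

/-- The conditional expected loss of the prediction `a` for the next outcome under `P`, given that
the first `n` outcomes were `x`. (It is `0` if this history has probability zero.) -/
noncomputable def condRisk {Z : Type u} {B : Type v} [MeasurableSpace Z]
    (P : Measure (ℕ → Z)) (ℓ : B → Z → ℝ) {n : ℕ} (x : Fin n → Z) (a : B) : ℝ :=
  ∫ ω, ℓ a (ω n) ∂(cond P (cylinder x))

/-- The prediction `a` minimizes the conditional expected loss under `P` given the history `x`.
(If the history has probability zero, every prediction does.) -/
def IsOptimalPrediction {Z : Type u} {B : Type v} [MeasurableSpace Z]
    (P : Measure (ℕ → Z)) (ℓ : B → Z → ℝ) {n : ℕ} (x : Fin n → Z) (a : B) : Prop :=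
  ∀ a' : B, condRisk P ℓ x a ≤ condRisk P ℓ x a'

/-- The policy `b`, which consists of measurable functions of the past outcomes, is optimal
with respect to `P`. -/
structure IsOptimalPolicy {Z : Type u} {B : Type v} [MeasurableSpace Z] [MeasurableSpace B]
    (P : Measure (ℕ → Z)) (ℓ : B → Z → ℝ) (b : (n : ℕ) → (Fin n → Z) → B) : Prop where
  measurable : ∀ n, Measurable (b n)
  optimal : ∀ n (x : Fin n → Z), IsOptimalPrediction P ℓ x (b n x)

/-- The average per-round regret of the policy `b` against the policy `b'` after `T` rounds. -/
noncomputable def avgRegret {Z : Type u} {B : Type v} (ℓ : B → Z → ℝ)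
    (b b' : (n : ℕ) → (Fin n → Z) → B) (T : ℕ) (ω : ℕ → Z) : ℝ :=
  (1 / (T : ℝ)) * ∑ n ∈ Finset.range T,
    (ℓ (b n fun i => ω i) (ω n) - ℓ (b' n fun i => ω i) (ω n))

end UniversalPrediction

open UniversalPrediction

/-! The mixture dominates each component: `w * P ≤ Q` (`mul_measureReal_law_le`). Let `d n` be the
loss difference of the two policies in round `n` and `r n` its conditional mean under `P`.
Optimality of `b'` gives `0 ≤ r n`, and optimality of `b` makes the conditional mean under `Q`
nonpositive, so `r n` is at most the difference of the two means. Its square is at most `8 L²` times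
the Hellinger discrepancy of the one-step predictions (`integral_sub_integral_sq_le_affinity`). By
the chain rule for log-likelihoods, domination bounds the expected total discrepancy by `log (1 / w)
/ 2` for all horizons at once (`sum_integral_one_sub_affinity_le`). Cauchy–Schwarz then bounds the
second moment of `∑ r n` by a multiple of `T`.

The remainder `d n - r n` is a bounded martingale difference, whose sum has second moment at most `4
L² T`. Together, `integral_sq_sum_le` gives `8 L² (1 - log w) T`, and Markov's inequality for the
square gives the rate `1 / √(T δ)`. -/

namespace UniversalPrediction

/-! ### Hellinger affinity on a countable space -/

section Discrete

/-- The Bhattacharyya coefficient (Hellinger affinity) of two discrete distributions. -/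
noncomputable def affinity {Z : Type*} [MeasurableSpace Z] (μ ν : Measure Z) : ℝ :=
  ∑' z, √(μ.real {z} * ν.real {z})

theorem affinity_nonneg {Z : Type*} [MeasurableSpace Z] (μ ν : Measure Z) : 0 ≤ affinity μ ν :=
  tsum_nonneg fun _ => Real.sqrt_nonneg _

theorem sqrt_mul_le_half_add {a b : ℝ} (ha : 0 ≤ a) (hb : 0 ≤ b) :
    √(a * b) ≤ (a + b) / 2 := by
  rw [Real.sqrt_mul ha]
  nlinarith [sq_nonneg (√a - √b), Real.sq_sqrt ha, Real.sq_sqrt hb]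

variable {Z : Type*} [Countable Z] [MeasurableSpace Z] [MeasurableSingletonClass Z]

theorem hasSum_measureReal_singleton (μ : Measure Z) [IsProbabilityMeasure μ] :
    HasSum (fun z => μ.real {z}) 1 := by
  have h := hasSum_integral_iUnion (μ := μ) (f := fun _ => (1 : ℝ)) (s := fun z : Z => {z})
    (fun z => measurableSet_singleton z)
    (fun a b hab => Set.disjoint_singleton.2 hab) (integrable_const _).integrableOn
  simpa [Set.iUnion_of_singleton, measureReal_def] using h

theorem summable_sqrt_mul (μ ν : Measure Z) [IsProbabilityMeasure μ] [IsProbabilityMeasure ν] :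
    Summable fun z => √(μ.real {z} * ν.real {z}) :=
  Summable.of_nonneg_of_le (fun _ => Real.sqrt_nonneg _)
    (fun _ => sqrt_mul_le_half_add measureReal_nonneg measureReal_nonneg)
    (((hasSum_measureReal_singleton μ).add (hasSum_measureReal_singleton ν)).div_const 2).summable

theorem affinity_le_one (μ ν : Measure Z) [IsProbabilityMeasure μ] [IsProbabilityMeasure ν] :
    affinity μ ν ≤ 1 := by
  have h := ((hasSum_measureReal_singleton μ).add (hasSum_measureReal_singleton ν)).div_const 2
  refine ((summable_sqrt_mul μ ν).tsum_le_tsum (fun z => sqrt_mul_le_half_add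
    measureReal_nonneg measureReal_nonneg) h.summable).trans ?_
  rw [h.tsum_eq]
  norm_num

/-- Cauchy–Schwarz for `s² - t² = (s - t)(s + t)`, where `s`, `t` are the roots of the point masses:
`∑ (s - t)² = 2 (1 - affinity)` and `∑ (s + t)² / 4 ≤ 1`. It is run as a discriminant argument in a
free parameter `c`. -/
theorem integral_sub_integral_sq_le_affinity (μ ν : Measure Z) [IsProbabilityMeasure μ]
    [IsProbabilityMeasure ν] {L : ℝ} (hL : 0 ≤ L) {g : Z → ℝ} (hg : ∀ z, |g z| ≤ L) :
    (∫ z, g z ∂μ - ∫ z, g z ∂ν) ^ 2 ≤ 8 * L ^ 2 * (1 - affinity μ ν) := by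
  have hsum : ∀ (ρ : Measure Z) [IsProbabilityMeasure ρ],
      HasSum (fun z => ρ.real {z} * g z) (∫ z, g z ∂ρ) := by
    intro ρ _
    have hi : Integrable g ρ :=
      Integrable.of_bound (measurable_of_countable g).aestronglyMeasurable L
        (Filter.Eventually.of_forall hg)
    rw [integral_countable hi]
    refine (Summable.of_norm_bounded
      ((hasSum_measureReal_singleton ρ).mul_right L).summable fun z => ?_).hasSum
    rw [Real.norm_eq_abs, abs_mul, abs_of_nonneg measureReal_nonneg]
    exact mul_le_mul_of_nonneg_left (hg z) measureReal_nonneg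
  have hμ := hasSum_measureReal_singleton μ
  have hν := hasSum_measureReal_singleton ν
  have hb := (summable_sqrt_mul μ ν).hasSum
  have key : ∀ c : ℝ, 0 ≤ L * (2 * (1 - affinity μ ν)) * (c * c) +
      -(∫ z, g z ∂μ - ∫ z, g z ∂ν) * c + L := by
    intro c
    have h1 := ((hsum μ).sub (hsum ν)).mul_left c
    have h2 := ((((hμ.add hν).sub (hb.mul_left 2)).mul_left (c ^ 2)).add
      (((hμ.add hν).add (hb.mul_left 2)).div_const 4)).mul_left L
    have h3 := hasSum_le (fun z => ?_) h1 h2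
    · have h4 := mul_le_mul_of_nonneg_left (affinity_le_one μ ν) hL
      unfold affinity at *
      nlinarith
    · have ha : 0 ≤ μ.real {z} := measureReal_nonneg
      have hb : 0 ≤ ν.real {z} := measureReal_nonneg
      rw [Real.sqrt_mul ha]
      obtain ⟨s, hs, hsa⟩ : ∃ s, 0 ≤ s ∧ s ^ 2 = μ.real {z} :=
        ⟨_, Real.sqrt_nonneg _, Real.sq_sqrt ha⟩
      obtain ⟨t, ht, htb⟩ : ∃ t, 0 ≤ t ∧ t ^ 2 = ν.real {z} :=
        ⟨_, Real.sqrt_nonneg _, Real.sq_sqrt hb⟩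
      rw [← hsa, ← htb, Real.sqrt_sq hs, Real.sqrt_sq ht]
      calc c * (s ^ 2 * g z - t ^ 2 * g z) = g z * (c * (s - t) * (s + t)) := by ring
        _ ≤ |g z| * |c * (s - t) * (s + t)| := by rw [← abs_mul]; exact le_abs_self _
        _ ≤ L * |c * (s - t) * (s + t)| := by gcongr; exact hg z
        _ ≤ L * ((c * (s - t)) ^ 2 + (s + t) ^ 2 / 4) := by
          gcongr
          rw [abs_le]
          constructor <;>
            nlinarith [sq_nonneg (c * (s - t) - (s + t) / 2), sq_nonneg (c * (s - t) + (s + t) / 2)]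
        _ = _ := by ring
  have := discrim_le_zero key
  unfold discrim at this
  nlinarith

theorem integrable_sqrt_div (μ ν : Measure Z) [IsProbabilityMeasure μ] [IsProbabilityMeasure ν] :
    Integrable (fun z => √(ν.real {z} / μ.real {z})) μ ∧
      ∫ z, √(ν.real {z} / μ.real {z}) ∂μ = affinity μ ν := by
  -- Points of `μ`-mass zero contribute zero on both sides, whatever the quotient is.
  have hz : ∀ z, μ.real {z} * √(ν.real {z} / μ.real {z}) = √(μ.real {z} * ν.real {z}) := by
    intro z
    have ha : 0 ≤ μ.real {z} := measureReal_nonneg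
    generalize μ.real {z} = a at *
    rcases ha.eq_or_lt with rfl | ha
    · simp
    · rw [Real.sqrt_div' _ ha.le, Real.sqrt_mul ha.le]
      nth_rw 1 [← Real.mul_self_sqrt ha.le]
      have := Real.sqrt_pos.2 ha
      field_simp
  have hi : Integrable (fun z => √(ν.real {z} / μ.real {z})) μ := by
    rw [← integrableOn_univ, ← Set.iUnion_of_singleton]
    refine integrableOn_iUnion_of_summable_integral_norm (fun z => ?_) ?_
    · exact integrableOn_singleton (by simp)
    · convert summable_sqrt_mul μ ν with z
      rw [← hz, integral_singleton, Real.norm_of_nonneg (Real.sqrt_nonneg _), smul_eq_mul]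
  refine ⟨hi, ?_⟩
  rw [integral_countable hi]
  exact tsum_congr hz

end Discrete

/-! ### Conditioning on finite histories -/

section Cylinder

/-- The first `n` outcomes of a sequence. -/
def initial {Z : Type u} (n : ℕ) (ω : ℕ → Z) : Fin n → Z := fun i => ω i

theorem mem_cylinder_iff {Z : Type u} {n : ℕ} {x : Fin n → Z} {ω : ℕ → Z} :
    ω ∈ cylinder x ↔ initial n ω = x := by
  simp [cylinder, initial, funext_iff]

theorem iUnion_cylinder {Z : Type u} (n : ℕ) : ⋃ x : Fin n → Z, cylinder x = Set.univ :=
  Set.iUnion_eq_univ_iff.2 fun ω => ⟨initial n ω, mem_cylinder_iff.2 rfl⟩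

theorem pairwise_disjoint_cylinder {Z : Type u} (n : ℕ) :
    Pairwise (Function.onFun Disjoint (cylinder (Z := Z) (n := n))) := by
  intro x y hxy
  refine Set.disjoint_left.2 fun ω hx hy => hxy ?_
  rw [← mem_cylinder_iff.1 hx, mem_cylinder_iff.1 hy]

theorem cylinder_initial_succ {Z : Type u} (n : ℕ) (ω : ℕ → Z) :
    cylinder (initial (n + 1) ω) = cylinder (initial n ω) ∩ {ω' | ω' n = ω n} := by
  ext ω'
  simp [cylinder, initial, Fin.forall_fin_succ']

variable {Z : Type u} [MeasurableSpace Z]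

/-- The expectation of `F` given the first `n` outcomes `x`. -/
noncomputable def condMean (P : Measure (ℕ → Z)) (F : (ℕ → Z) → ℝ) {n : ℕ} (x : Fin n → Z) : ℝ :=
  ∫ ω, F ω ∂(cond P (cylinder x))

theorem condMean_eq (P : Measure (ℕ → Z)) (F : (ℕ → Z) → ℝ) {n : ℕ} (x : Fin n → Z) :
    condMean P F x = (P.real (cylinder x))⁻¹ * ∫ ω in cylinder x, F ω ∂P := by
  rw [condMean, ProbabilityTheory.cond, integral_smul_measure, ENNReal.toReal_inv, smul_eq_mul, measureReal_def]

/-- The distribution of the next outcome given the first outcomes `x`. -/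
noncomputable def nextLaw (P : Measure (ℕ → Z)) {n : ℕ} (x : Fin n → Z) : Measure Z :=
  (cond P (cylinder x)).map fun ω => ω n

theorem isProbabilityMeasure_nextLaw {P : Measure (ℕ → Z)} [IsFiniteMeasure P] {n : ℕ}
    {x : Fin n → Z} (h : 0 < P.real (cylinder x)) : IsProbabilityMeasure (nextLaw P x) := by
  have : IsProbabilityMeasure (cond P (cylinder x)) :=
    cond_isProbabilityMeasure fun h0 => h.ne' (by simp [measureReal_def, h0])
  exact Measure.isProbabilityMeasure_map (measurable_pi_apply n).aemeasurable

theorem nextLaw_of_null {P : Measure (ℕ → Z)} {n : ℕ} {x : Fin n → Z}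
    (h : P (cylinder x) = 0) : nextLaw P x = 0 := by
  rw [nextLaw, cond_eq_zero_of_meas_eq_zero h, Measure.map_zero]

theorem integrableOn_cylinder_next {P : Measure (ℕ → Z)} [IsFiniteMeasure P] {n : ℕ}
    {x : Fin n → Z} {g : Z → ℝ} (hg : Integrable g (nextLaw P x)) :
    IntegrableOn (fun ω => g (ω n)) (cylinder x) P := by
  by_cases h : P (cylinder x) = 0
  · rw [IntegrableOn, Measure.restrict_eq_zero.2 h]
    exact integrable_zero_measure
  · have := hg.comp_measurable (measurable_pi_apply n)
    rw [ProbabilityTheory.cond, integrable_smul_measure (by simp) (by simpa using h)] at this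
    exact this

theorem integrable_of_abs_le {P : Measure (ℕ → Z)} [IsFiniteMeasure P] {F : (ℕ → Z) → ℝ} (hF : Measurable F) {K : ℝ}
    (h : ∀ ω, |F ω| ≤ K) : Integrable F P :=
  Integrable.of_bound hF.aestronglyMeasurable K (Filter.Eventually.of_forall h)

/-- In this multiplied form null histories need no exception, since both sides vanish there. -/
theorem measureReal_mul_condMean (P : Measure (ℕ → Z)) [IsFiniteMeasure P] (F : (ℕ → Z) → ℝ)
    {n : ℕ} (x : Fin n → Z) :
    P.real (cylinder x) * condMean P F x = ∫ ω in cylinder x, F ω ∂P := by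
  rw [condMean_eq]
  by_cases h : P.real (cylinder x) = 0
  · have : P (cylinder x) = 0 := by simpa [measureReal_def, ENNReal.toReal_eq_zero_iff] using h
    simp [h, Measure.restrict_eq_zero.2 this]
  · rw [mul_inv_cancel_left₀ h]

theorem abs_integral_nextLaw_le {P : Measure (ℕ → Z)} [IsFiniteMeasure P] {n : ℕ}
    (x : Fin n → Z) {g : Z → ℝ} {L : ℝ} (hL : 0 ≤ L) (hg : ∀ z, |g z| ≤ L) : |∫ z, g z ∂nextLaw P x| ≤ L := by
  by_cases h : P (cylinder x) = 0
  · rw [nextLaw_of_null h]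
    simpa using hL
  · have hP := isProbabilityMeasure_nextLaw (P := P) (ENNReal.toReal_pos h (measure_ne_top _ _))
    simpa using norm_integral_le_of_norm_le_const (μ := nextLaw P x) (f := g)
      (Filter.Eventually.of_forall hg)

theorem absolutelyContinuous_of_mul_measureReal_le {P Q : Measure (ℕ → Z)} [IsFiniteMeasure P]
    {w : ℝ} (hw : 0 < w) (hPQ : ∀ s, w * P.real s ≤ Q.real s) : P ≪ Q := by
  intro s hs
  have h1 := hPQ s
  have h2 : P.real s = 0 := by
    have h3 : 0 ≤ P.real s := measureReal_nonneg
    rw [measureReal_def Q, hs, ENNReal.toReal_zero] at h1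
    nlinarith
  simpa [measureReal_def, ENNReal.toReal_eq_zero_iff] using h2

variable [Countable Z]

theorem ae_cylinder_pos (P : Measure (ℕ → Z)) [IsFiniteMeasure P] :
    ∀ᵐ ω ∂P, ∀ n, 0 < P.real (cylinder (initial n ω)) := by
  refine ae_all_iff.2 fun n => ?_
  have : P (⋃ x : {x : Fin n → Z // P (cylinder x) = 0}, cylinder x.1) = 0 :=
    measure_iUnion_null fun x => x.2
  filter_upwards [measure_eq_zero_iff_ae_notMem.1 this] with ω hω
  refine ENNReal.toReal_pos (fun h => hω ?_) (measure_ne_top _ _)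
  exact Set.mem_iUnion.2 ⟨⟨initial n ω, h⟩, mem_cylinder_iff.2 rfl⟩

variable [DiscreteMeasurableSpace Z]

theorem measurable_comp_initial {X : Type*} [MeasurableSpace X] {n : ℕ} (f : (Fin n → Z) → X) :
    Measurable fun ω : ℕ → Z => f (initial n ω) := by
  refine (measurable_of_countable f).comp ?_
  unfold initial
  fun_prop

theorem measurableSet_cylinder {n : ℕ} (x : Fin n → Z) : MeasurableSet (cylinder x) := by
  have : cylinder x = {ω | initial n ω = x} := Set.ext fun _ => mem_cylinder_iff
  rw [this]
  exact measurableSet_eq_fun (measurable_comp_initial id) measurable_const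

theorem condMean_congr (P : Measure (ℕ → Z)) {F G : (ℕ → Z) → ℝ} {n : ℕ} {x : Fin n → Z}
    (h : ∀ ω ∈ cylinder x, F ω = G ω) : condMean P F x = condMean P G x := by
  rw [condMean_eq, condMean_eq, setIntegral_congr_fun (measurableSet_cylinder x) h]

theorem setIntegral_cylinder_comp_initial (P : Measure (ℕ → Z)) {n : ℕ}
    (f : (Fin n → Z) → ℝ) (x : Fin n → Z) :
    ∫ ω in cylinder x, f (initial n ω) ∂P = P.real (cylinder x) * f x := by
  rw [setIntegral_congr_fun (g := fun _ => f x) (measurableSet_cylinder x)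
    fun ω hω => by simp only [mem_cylinder_iff.1 hω], setIntegral_const, smul_eq_mul]

theorem integral_eq_tsum_cylinder (P : Measure (ℕ → Z)) (n : ℕ) {F : (ℕ → Z) → ℝ}
    (hF : Integrable F P) :
    ∫ ω, F ω ∂P = ∑' x : Fin n → Z, ∫ ω in cylinder x, F ω ∂P := by
  rw [← setIntegral_univ, ← iUnion_cylinder n]
  exact integral_iUnion measurableSet_cylinder (pairwise_disjoint_cylinder n)
    (hF.integrableOn)

/-- The tower property, with factors depending on the first `n` outcomes taken out. -/
theorem integral_mul_condMean (P : Measure (ℕ → Z)) [IsFiniteMeasure P] {n : ℕ}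
    {F : (ℕ → Z) → ℝ} (f : (Fin n → Z) → ℝ)
    (hF : Integrable (fun ω => f (initial n ω) * F ω) P)
    (hc : Integrable (fun ω => f (initial n ω) * condMean P F (initial n ω)) P) :
    ∫ ω, f (initial n ω) * condMean P F (initial n ω) ∂P = ∫ ω, f (initial n ω) * F ω ∂P := by
  rw [integral_eq_tsum_cylinder P n hF, integral_eq_tsum_cylinder P n hc]
  refine tsum_congr fun x => ?_
  rw [setIntegral_cylinder_comp_initial P (fun x => f x * condMean P F x),
    mul_left_comm, measureReal_mul_condMean, ← integral_const_mul]
  refine setIntegral_congr_fun (measurableSet_cylinder x) fun ω hω => ?_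
  simp only [mem_cylinder_iff.1 hω]

theorem summable_measureReal_cylinder (P : Measure (ℕ → Z)) [IsFiniteMeasure P] (n : ℕ) :
    Summable fun x : Fin n → Z => P.real (cylinder x) := by
  have h := hasSum_integral_iUnion (μ := P) (f := fun _ => (1 : ℝ)) (s := cylinder (n := n))
    measurableSet_cylinder (pairwise_disjoint_cylinder n) (integrable_const _).integrableOn
  simpa [measureReal_def] using h.summable

/-- Serves the likelihood ratio `sqrtRatio`, which need not be bounded: the integral over each
cylinder is at most `K` times its probability, and these are summable. -/
theorem integrable_of_condMean_le (P : Measure (ℕ → Z)) [IsFiniteMeasure P] {n : ℕ}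
    {F : (ℕ → Z) → ℝ} {K : ℝ} (h0 : ∀ ω, 0 ≤ F ω)
    (hi : ∀ x : Fin n → Z, IntegrableOn F (cylinder x) P)
    (hK : ∀ x : Fin n → Z, condMean P F x ≤ K) : Integrable F P := by
  rw [← integrableOn_univ, ← iUnion_cylinder n]
  refine integrableOn_iUnion_of_summable_integral_norm hi
    (((summable_measureReal_cylinder P n).mul_right K).of_nonneg_of_le (fun _ => by positivity)
    fun x => ?_)
  simp_rw [fun ω => Real.norm_of_nonneg (h0 ω)]
  rw [← measureReal_mul_condMean]
  exact mul_le_mul_of_nonneg_left (hK x) measureReal_nonneg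

theorem condMean_next (P : Measure (ℕ → Z)) {n : ℕ} (x : Fin n → Z) (g : Z → ℝ) :
    condMean P (fun ω => g (ω n)) x = ∫ z, g z ∂nextLaw P x := by
  rw [nextLaw, integral_map (measurable_pi_apply n).aemeasurable (measurable_of_countable g).aestronglyMeasurable]
  rfl

/-- The chain rule, which makes log-likelihoods telescope along a path. -/
theorem measureReal_cylinder_succ (P : Measure (ℕ → Z)) [IsFiniteMeasure P] (n : ℕ) (ω : ℕ → Z) :
    P.real (cylinder (initial (n + 1) ω)) =
      P.real (cylinder (initial n ω)) * (nextLaw P (initial n ω)).real {ω n} := by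
  have hs : (fun ω' : ℕ → Z => ω' n) ⁻¹' {ω n} = {ω' | ω' n = ω n} := rfl
  rw [nextLaw, map_measureReal_apply (by fun_prop) (measurableSet_singleton _), hs,
    cylinder_initial_succ, measureReal_def, measureReal_def, measureReal_def,
    ← cond_mul_eq_inter (measurableSet_cylinder _), ENNReal.toReal_mul, mul_comm]

end Cylinder

/-! ### Martingale differences -/

section Deviation

variable {Z : Type u} [MeasurableSpace Z]

/-- The deviation of the `n`-th term from its expectation given the outcomes before it. -/
noncomputable def deviation (P : Measure (ℕ → Z)) (d : (n : ℕ) → (Fin n → Z) → Z → ℝ) (n : ℕ)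
    (ω : ℕ → Z) : ℝ :=
  d n (initial n ω) (ω n) - ∫ z, d n (initial n ω) z ∂nextLaw P (initial n ω)

variable {P : Measure (ℕ → Z)} [IsProbabilityMeasure P]
  {d : (n : ℕ) → (Fin n → Z) → Z → ℝ} {L : ℝ}

theorem abs_deviation_le (hL : 0 ≤ L) (hd : ∀ n x z, |d n x z| ≤ L) (n : ℕ) (ω : ℕ → Z) :
    |deviation P d n ω| ≤ 2 * L := by
  have h1 := abs_le.1 (hd n (initial n ω) (ω n))
  have h2 := abs_le.1 (abs_integral_nextLaw_le (P := P) (initial n ω) hL (hd n (initial n ω)))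
  rw [deviation, abs_le]
  constructor <;> linarith

theorem abs_sum_deviation_le (hL : 0 ≤ L) (hd : ∀ n x z, |d n x z| ≤ L) (T : ℕ) (ω : ℕ → Z) :
    |∑ n ∈ Finset.range T, deviation P d n ω| ≤ T * (2 * L) := by
  refine (Finset.abs_sum_le_sum_abs _ _).trans ?_
  refine (Finset.sum_le_sum fun n _ => abs_deviation_le hL hd n ω).trans ?_
  simp

end Deviation

/-! ### Hellinger discrepancy along a path -/

section Regret

variable {Z : Type u} [Countable Z] [MeasurableSpace Z] [DiscreteMeasurableSpace Z]

/-- The square root of the ratio of the conditional probabilities that `Q` and `P` assign to the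
outcome `ω n` given the outcomes before it. -/
noncomputable def sqrtRatio (P Q : Measure (ℕ → Z)) (n : ℕ) (ω : ℕ → Z) : ℝ :=
  √((nextLaw Q (initial n ω)).real {ω n} / (nextLaw P (initial n ω)).real {ω n})

theorem measurable_comp_initial_next {n : ℕ} (f : (Fin n → Z) → Z → ℝ) :
    Measurable fun ω : ℕ → Z => f (initial n ω) (ω n) :=
  (measurable_of_countable (Function.uncurry f)).comp
    ((measurable_comp_initial id).prodMk (measurable_pi_apply n))

section Dominated

variable {P Q : Measure (ℕ → Z)} [IsProbabilityMeasure P] [IsProbabilityMeasure Q]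

/-- Absolute continuity makes both predictive laws probability measures on `P`-positive histories;
on `P`-null ones both sides of the equality are zero. -/
theorem condMean_sqrtRatio (hPQ : P ≪ Q) {n : ℕ} (x : Fin n → Z) :
    condMean P (sqrtRatio P Q n) x = affinity (nextLaw P x) (nextLaw Q x) ∧
      IntegrableOn (sqrtRatio P Q n) (cylinder x) P := by
  by_cases h : P (cylinder x) = 0
  · refine ⟨?_, ?_⟩
    · rw [nextLaw_of_null h, condMean, cond_eq_zero_of_meas_eq_zero h]
      simp [affinity]
    · rw [IntegrableOn, Measure.restrict_eq_zero.2 h]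
      exact integrable_zero_measure
  · have hP := isProbabilityMeasure_nextLaw (P := P) (ENNReal.toReal_pos h (measure_ne_top _ _))
    have hQ := isProbabilityMeasure_nextLaw (P := Q)
      (ENNReal.toReal_pos (mt (@hPQ (cylinder x)) h) (measure_ne_top _ _))
    obtain ⟨h1, h2⟩ := integrable_sqrt_div (nextLaw P x) (nextLaw Q x)
    have hc : ∀ ω ∈ cylinder x, sqrtRatio P Q n ω =
        √((nextLaw Q x).real {ω n} / (nextLaw P x).real {ω n}) := by
      intro ω hω
      rw [sqrtRatio, mem_cylinder_iff.1 hω]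
    refine ⟨?_, ?_⟩
    · rw [condMean_congr P hc, ← h2, ← condMean_next]
    · exact (integrableOn_congr_fun hc (measurableSet_cylinder x)).2
        (integrableOn_cylinder_next h1)

theorem affinity_nextLaw_le_one (hPQ : P ≪ Q) {n : ℕ} (x : Fin n → Z) :
    affinity (nextLaw P x) (nextLaw Q x) ≤ 1 := by
  by_cases h : P (cylinder x) = 0
  · rw [nextLaw_of_null h]
    simp [affinity]
  · have hP := isProbabilityMeasure_nextLaw (P := P) (ENNReal.toReal_pos h (measure_ne_top _ _))
    have hQ := isProbabilityMeasure_nextLaw (P := Q)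
      (ENNReal.toReal_pos (mt (@hPQ (cylinder x)) h) (measure_ne_top _ _))
    exact affinity_le_one _ _

theorem integrable_sqrtRatio (hPQ : P ≪ Q) (n : ℕ) : Integrable (sqrtRatio P Q n) P :=
  integrable_of_condMean_le P (n := n) (K := 1) (fun _ => Real.sqrt_nonneg _)
    (fun x => (condMean_sqrtRatio hPQ x).2)
    (fun x => (condMean_sqrtRatio hPQ x).1.trans_le (affinity_nextLaw_le_one hPQ x))

theorem integrable_affinity (hPQ : P ≪ Q) (n : ℕ) :
    Integrable (fun ω => affinity (nextLaw P (initial n ω)) (nextLaw Q (initial n ω))) P := by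
  refine Integrable.of_bound (measurable_comp_initial
    fun x : Fin n → Z => affinity (nextLaw P x) (nextLaw Q x)).aestronglyMeasurable 1
    (Filter.Eventually.of_forall fun ω => ?_)
  rw [Real.norm_of_nonneg (affinity_nonneg _ _)]
  exact affinity_nextLaw_le_one hPQ _

theorem integral_sqrtRatio (hPQ : P ≪ Q) (n : ℕ) :
    ∫ ω, sqrtRatio P Q n ω ∂P =
      ∫ ω, affinity (nextLaw P (initial n ω)) (nextLaw Q (initial n ω)) ∂P := by
  have h := integral_mul_condMean P (n := n) (F := sqrtRatio P Q n) (fun _ => 1)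
    (by simpa using integrable_sqrtRatio hPQ n)
    (by simpa [(condMean_sqrtRatio hPQ _).1] using integrable_affinity hPQ n)
  simpa [(condMean_sqrtRatio hPQ _).1] using h.symm

/-- If `Q` dominates `w • P`, the total expected Hellinger discrepancy between the one-step
predictive distributions is at most `log (1 / w) / 2`. -/
theorem sum_integral_one_sub_affinity_le {w : ℝ} (hw : 0 < w)
    (hPQ : ∀ s, w * P.real s ≤ Q.real s) (T : ℕ) :
    ∑ n ∈ Finset.range T,
      ∫ ω, (1 - affinity (nextLaw P (initial n ω)) (nextLaw Q (initial n ω))) ∂P ≤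
        -Real.log w / 2 := by
  have hac : P ≪ Q := absolutelyContinuous_of_mul_measureReal_le hw hPQ
  have hi : ∀ n ∈ Finset.range T, Integrable (fun ω => 1 - sqrtRatio P Q n ω) P :=
    fun n _ => (integrable_const _).sub (integrable_sqrtRatio hac n)
  have h1 : ∑ n ∈ Finset.range T,
      ∫ ω, (1 - affinity (nextLaw P (initial n ω)) (nextLaw Q (initial n ω))) ∂P =
        ∫ ω, ∑ n ∈ Finset.range T, (1 - sqrtRatio P Q n ω) ∂P := by
    rw [integral_finsetSum _ hi]
    refine Finset.sum_congr rfl fun n _ => ?_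
    rw [integral_sub (integrable_const _) (integrable_sqrtRatio hac n), integral_sqrtRatio hac,
      integral_sub (integrable_const _) (integrable_affinity hac n)]
  rw [h1]
  have h2 : ∫ _ω, -Real.log w / 2 ∂P = -Real.log w / 2 := by simp
  rw [← h2]
  refine integral_mono_ae (integrable_finsetSum _ hi) (integrable_const _) ?_
  filter_upwards [ae_cylinder_pos P] with ω hω
  have hq : ∀ n, 0 < Q.real (cylinder (initial n ω)) := fun n =>
    (mul_pos hw (hω n)).trans_le (hPQ _)
  have h0 : ∀ R : Measure (ℕ → Z), IsProbabilityMeasure R →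
      R.real (cylinder (initial 0 ω)) = 1 := by
    intro R _
    have : cylinder (initial 0 ω) = Set.univ := Set.eq_univ_of_forall fun _ => by
      simp [cylinder]
    rw [this, probReal_univ]
  -- `1 - √(q / p) ≤ -log √(q / p) = (log p - log q) / 2`, and the right-hand sides telescope.
  have tele : ∀ T : ℕ, ∑ n ∈ Finset.range T, (1 - sqrtRatio P Q n ω) ≤
      (Real.log (P.real (cylinder (initial T ω))) -
        Real.log (Q.real (cylinder (initial T ω)))) / 2 := by
    intro T
    induction T with
    | zero => simp [h0 P inferInstance, h0 Q inferInstance]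
    | succ T ih =>
      have hp' := hω (T + 1)
      have hq' := hq (T + 1)
      rw [measureReal_cylinder_succ] at hp' hq'
      have hp1 := pos_of_mul_pos_right hp' (hω T).le
      have hq1 := pos_of_mul_pos_right hq' (hq T).le
      rw [Finset.sum_range_succ, measureReal_cylinder_succ, measureReal_cylinder_succ,
        Real.log_mul (hω T).ne' hp1.ne', Real.log_mul (hq T).ne' hq1.ne']
      have h3 := Real.log_le_sub_one_of_pos (Real.sqrt_pos.2 (div_pos hq1 hp1))
      rw [Real.log_sqrt (div_pos hq1 hp1).le, Real.log_div hq1.ne' hp1.ne'] at h3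
      rw [sqrtRatio]
      linarith
  refine (tele T).trans ?_
  have h4 := Real.log_le_log (mul_pos hw (hω T)) (hPQ (cylinder (initial T ω)))
  rw [Real.log_mul hw.ne' (hω T).ne'] at h4
  linarith

end Dominated

/-! ### Second moments of the cumulative regret -/

section SecondMoment

theorem measurable_deviation (P : Measure (ℕ → Z)) (d : (n : ℕ) → (Fin n → Z) → Z → ℝ)
    (n : ℕ) :
    Measurable (deviation P d n) :=
  measurable_comp_initial_next fun x z => d n x z - ∫ z, d n x z ∂nextLaw P x

variable {P : Measure (ℕ → Z)} [IsProbabilityMeasure P]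
  {d : (n : ℕ) → (Fin n → Z) → Z → ℝ} {L : ℝ}

theorem integral_sum_mul_deviation (hL : 0 ≤ L) (hd : ∀ n x z, |d n x z| ≤ L) (T : ℕ) :
    ∫ ω, (∑ n ∈ Finset.range T, deviation P d n ω) * deviation P d T ω ∂P = 0 := by
  -- The past deviations are determined by the first `T` outcomes, so their sum can be taken out in
  -- the tower property.
  have hfac : Function.FactorsThrough
      (fun ω => ∑ n ∈ Finset.range T, deviation P d n ω) (initial (Z := Z) T) := by
    intro ω ω' h
    refine Finset.sum_congr rfl fun n hn => ?_
    have hk : ∀ k < T, ω k = ω' k := fun k hk => congrFun h ⟨k, hk⟩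
    have hn' := Finset.mem_range.1 hn
    have h1 : initial n ω = initial n ω' := funext fun i => hk i (i.2.trans hn')
    rw [deviation, deviation, h1, hk n hn']
  obtain ⟨f, hf⟩ := (Function.factorsThrough_iff _).1 hfac
  have hfa : ∀ ω, ∑ n ∈ Finset.range T, deviation P d n ω = f (initial T ω) := congrFun hf
  have hfb : ∀ ω : ℕ → Z, |f (initial T ω)| ≤ T * (2 * L) := fun ω => by
    rw [← hfa]; exact abs_sum_deviation_le hL hd T ω
  have hcm : ∀ x : Fin T → Z, condMean P (fun ω => d T (initial T ω) (ω T)) x =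
      ∫ z, d T x z ∂nextLaw P x := by
    intro x
    rw [← condMean_next]
    exact condMean_congr P fun ω hω => by rw [mem_cylinder_iff.1 hω]
  have hi1 : Integrable (fun ω => f (initial T ω) * d T (initial T ω) (ω T)) P :=
    integrable_of_abs_le (K := T * (2 * L) * L)
      ((measurable_comp_initial f).mul (measurable_comp_initial_next (d T))) fun ω => by
      rw [abs_mul]
      exact mul_le_mul (hfb ω) (hd _ _ _) (abs_nonneg _) (by positivity)
  have hi2 : Integrable (fun ω => f (initial T ω) *
      ∫ z, d T (initial T ω) z ∂nextLaw P (initial T ω)) P :=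
    integrable_of_abs_le (K := T * (2 * L) * L)
      ((measurable_comp_initial f).mul
        (measurable_comp_initial fun x => ∫ z, d T x z ∂nextLaw P x)) fun ω => by
      rw [abs_mul]
      exact mul_le_mul (hfb ω) (abs_integral_nextLaw_le _ hL (hd _ _)) (abs_nonneg _)
        (by positivity)
  have ht := integral_mul_condMean P f hi1 (by simpa only [hcm] using hi2)
  simp only [hcm] at ht
  simp only [hfa]
  simp only [deviation, mul_sub]
  rw [integral_sub hi1 hi2, ht, sub_self]

/-- Martingale differences are orthogonal, and each square is at most `(2 L)²`. -/
theorem integral_sq_sum_deviation_le (hL : 0 ≤ L) (hd : ∀ n x z, |d n x z| ≤ L) (T : ℕ) :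
    ∫ ω, (∑ n ∈ Finset.range T, deviation P d n ω) ^ 2 ∂P ≤ 4 * L ^ 2 * T := by
  induction T with
  | zero => simp
  | succ T ih =>
    have hm : Measurable fun ω => ∑ n ∈ Finset.range T, deviation P d n ω :=
      Finset.measurable_sum _ fun n _ => measurable_deviation P d n
    have hb := abs_sum_deviation_le (P := P) hL hd T
    have hb' := abs_deviation_le (P := P) hL hd T
    have i1 : Integrable (fun ω => (∑ n ∈ Finset.range T, deviation P d n ω) ^ 2) P :=
      integrable_of_abs_le (K := (T * (2 * L)) ^ 2) (hm.pow_const 2) fun ω => by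
        rw [abs_pow]; exact pow_le_pow_left₀ (abs_nonneg _) (hb ω) 2
    have i2 : Integrable (fun ω =>
        (∑ n ∈ Finset.range T, deviation P d n ω) * deviation P d T ω) P :=
      integrable_of_abs_le (K := T * (2 * L) * (2 * L)) (hm.mul (measurable_deviation P d T))
        fun ω => by
        rw [abs_mul]; exact mul_le_mul (hb ω) (hb' ω) (abs_nonneg _) (by positivity)
    have hs : ∀ ω, (deviation P d T ω) ^ 2 ≤ (2 * L) ^ 2 := fun ω => by
      rw [← sq_abs]; exact pow_le_pow_left₀ (abs_nonneg _) (hb' ω) 2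
    have i3 : Integrable (fun ω => (deviation P d T ω) ^ 2) P :=
      integrable_of_abs_le (K := (2 * L) ^ 2) ((measurable_deviation P d T).pow_const 2)
        fun ω => by rw [abs_of_nonneg (sq_nonneg _)]; exact hs ω
    have h3 : ∫ ω, (deviation P d T ω) ^ 2 ∂P ≤ 4 * L ^ 2 := by
      refine (integral_mono i3 (integrable_const ((2 * L) ^ 2)) hs).trans_eq ?_
      simp
      ring
    simp only [Finset.sum_range_succ, add_sq, mul_assoc (2 : ℝ)]
    have i12 : Integrable (fun ω => (∑ n ∈ Finset.range T, deviation P d n ω) ^ 2 +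
        2 * ((∑ n ∈ Finset.range T, deviation P d n ω) * deviation P d T ω)) P :=
      i1.add (i2.const_mul 2)
    rw [integral_add i12 i3, integral_add i1 (i2.const_mul 2), integral_const_mul,
      integral_sum_mul_deviation hL hd]
    push_cast
    linarith

variable {Q : Measure (ℕ → Z)} [IsProbabilityMeasure Q]

/-- Second-moment bound for a sum whose conditional means are nonnegative under `P` and nonpositive
under a distribution `Q` dominating `w • P`. -/
theorem integral_sq_sum_le (hL : 0 ≤ L) (hd : ∀ n x z, |d n x z| ≤ L)
    (hP : ∀ n (x : Fin n → Z), 0 ≤ ∫ z, d n x z ∂nextLaw P x)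
    (hQ : ∀ n (x : Fin n → Z), ∫ z, d n x z ∂nextLaw Q x ≤ 0)
    {w : ℝ} (hw : 0 < w) (hPQ : ∀ s, w * P.real s ≤ Q.real s) (T : ℕ) :
    ∫ ω, (∑ n ∈ Finset.range T, d n (initial n ω) (ω n)) ^ 2 ∂P ≤
      8 * L ^ 2 * (1 - Real.log w) * T := by
  have hac : P ≪ Q := absolutelyContinuous_of_mul_measureReal_le hw hPQ
  let r : (n : ℕ) → (ℕ → Z) → ℝ := fun n ω => ∫ z, d n (initial n ω) z ∂nextLaw P (initial n ω)
  have hrm : ∀ n, Measurable (r n) := fun n =>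
    measurable_comp_initial fun x => ∫ z, d n x z ∂nextLaw P x
  have hrb : ∀ n ω, |r n ω| ≤ L := fun n ω => abs_integral_nextLaw_le _ hL (hd _ _)
  have hri : ∀ n, Integrable (fun ω => r n ω ^ 2) P := fun n =>
    integrable_of_abs_le (K := L ^ 2) ((hrm n).pow_const 2) fun ω => by
      rw [abs_pow]; exact pow_le_pow_left₀ (abs_nonneg _) (hrb n ω) 2
  have hr : ∀ n, ∫ ω, r n ω ^ 2 ∂P ≤ 8 * L ^ 2 *
      ∫ ω, (1 - affinity (nextLaw P (initial n ω)) (nextLaw Q (initial n ω))) ∂P := by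
    intro n
    rw [← integral_const_mul]
    refine integral_mono_ae (hri n)
      (((integrable_const 1).sub (integrable_affinity hac n)).const_mul _) ?_
    filter_upwards [ae_cylinder_pos P] with ω hω
    have i1 := isProbabilityMeasure_nextLaw (hω n)
    have i2 := isProbabilityMeasure_nextLaw ((mul_pos hw (hω n)).trans_le (hPQ _))
    refine le_trans ?_ (integral_sub_integral_sq_le_affinity _ _ hL (hd n (initial n ω)))
    -- The opposite signs of the two means enter here: `0 ≤ r n ≤ r n - ∫ d ∂(nextLaw Q)`.
    refine pow_le_pow_left₀ (hP _ _) ?_ 2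
    linarith [hQ n (initial n ω)]
  -- Cauchy–Schwarz costs the factor `T`; the sum of squares is bounded independently of `T`.
  have hA : ∫ ω, (∑ n ∈ Finset.range T, r n ω) ^ 2 ∂P ≤ T * (4 * L ^ 2 * -Real.log w) := by
    calc ∫ ω, (∑ n ∈ Finset.range T, r n ω) ^ 2 ∂P
        ≤ ∫ ω, T * ∑ n ∈ Finset.range T, r n ω ^ 2 ∂P := by
          refine integral_mono_of_nonneg (Filter.Eventually.of_forall fun ω => sq_nonneg _)
            ((integrable_finsetSum _ fun n _ => hri n).const_mul _)
            (Filter.Eventually.of_forall fun ω => ?_)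
          simpa using sq_sum_le_card_mul_sum_sq (s := Finset.range T) (f := fun n => r n ω)
      _ = T * ∑ n ∈ Finset.range T, ∫ ω, r n ω ^ 2 ∂P := by
          rw [integral_const_mul, integral_finsetSum _ fun n _ => hri n]
      _ ≤ T * (8 * L ^ 2 * (-Real.log w / 2)) := by
          gcongr
          refine (Finset.sum_le_sum fun n _ => hr n).trans ?_
          rw [← Finset.mul_sum]
          gcongr
          exact sum_integral_one_sub_affinity_le hw hPQ T
      _ = _ := by ring
  have hM := integral_sq_sum_deviation_le (P := P) hL hd T
  have iM : Integrable (fun ω => (∑ n ∈ Finset.range T, deviation P d n ω) ^ 2) P :=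
    integrable_of_abs_le (K := (T * (2 * L)) ^ 2)
      ((Finset.measurable_sum _ fun n _ => measurable_deviation P d n).pow_const 2) fun ω => by
      rw [abs_pow]; exact pow_le_pow_left₀ (abs_nonneg _) (abs_sum_deviation_le hL hd T ω) 2
  have iA : Integrable (fun ω => (∑ n ∈ Finset.range T, r n ω) ^ 2) P :=
    integrable_of_abs_le (K := (T * L) ^ 2)
      ((Finset.measurable_sum _ fun n _ => hrm n).pow_const 2) fun ω => by
      rw [abs_pow]
      refine pow_le_pow_left₀ (abs_nonneg _) ?_ 2
      refine (Finset.abs_sum_le_sum_abs _ _).trans ?_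
      exact (Finset.sum_le_sum fun n _ => hrb n ω).trans (by simp)
  calc ∫ ω, (∑ n ∈ Finset.range T, d n (initial n ω) (ω n)) ^ 2 ∂P
      ≤ ∫ ω, (2 * (∑ n ∈ Finset.range T, deviation P d n ω) ^ 2 +
          2 * (∑ n ∈ Finset.range T, r n ω) ^ 2) ∂P := by
        refine integral_mono_of_nonneg (Filter.Eventually.of_forall fun ω => sq_nonneg _)
          ((iM.const_mul 2).add (iA.const_mul 2)) (Filter.Eventually.of_forall fun ω => ?_)
        have hsum : ∑ n ∈ Finset.range T, d n (initial n ω) (ω n) =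
            ∑ n ∈ Finset.range T, deviation P d n ω + ∑ n ∈ Finset.range T, r n ω := by
          rw [← Finset.sum_add_distrib]
          exact Finset.sum_congr rfl fun n _ => (sub_add_cancel _ _).symm
        simp only [hsum]
        nlinarith [sq_nonneg (∑ n ∈ Finset.range T, deviation P d n ω -
          ∑ n ∈ Finset.range T, r n ω)]
    _ = 2 * ∫ ω, (∑ n ∈ Finset.range T, deviation P d n ω) ^ 2 ∂P +
          2 * ∫ ω, (∑ n ∈ Finset.range T, r n ω) ^ 2 ∂P := by
        rw [integral_add (iM.const_mul 2) (iA.const_mul 2), integral_const_mul,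
          integral_const_mul]
    _ ≤ _ := by linarith

end SecondMoment

end Regret

/-! ### Programs, weights and the mixture -/

section Programs

/-- A word and the word of its letters' codes have the same number, so a program written for words
over `ℕ` serves `Z` without any computability structure on `Z`. -/
theorem encode_map_encode {Z : Type u} [Encodable Z] (l : List Z) :
    Encodable.encode (l.map Encodable.encode) = Encodable.encode l := by
  induction l with
  | nil => simp
  | cons a l ih => simp [ih]

theorem foldl_ite_eq (e : ℕ) (l : List ℕ) (s : ℕ) :
    l.foldl (fun s a => if a = e then s else 0) s = if ∀ a ∈ l, a = e then s else 0 := by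
  induction l generalizing s with
  | nil => simp
  | cons a l ih =>
    rw [List.foldl_cons, ih]
    by_cases h : a = e <;> simp [h]

theorem exists_code_constant (e : ℕ) : ∃ c : Nat.Partrec.Code, ∀ (l : List ℕ) (k : ℕ),
    (if ∀ a ∈ l, a = e then 2 ^ k else 0) ∈ c.eval (Encodable.encode (l, k)) := by
  have hp : Primrec fun p : List ℕ × ℕ =>
      p.1.foldl (fun s a => if a = e then s else 0) (2 ^ p.2) := by
    refine Primrec.list_foldl (h := fun _ q => if q.2 = e then q.1 else 0) Primrec.fst ?_ ?_
    · exact (Primrec₂.unpaired'.1 Nat.Primrec.pow).comp (Primrec.const 2) Primrec.snd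
    · exact Primrec.ite (Primrec.eq.comp (Primrec.snd.comp Primrec.snd) (Primrec.const e))
        (Primrec.fst.comp Primrec.snd) (Primrec.const 0)
  obtain ⟨c, hc⟩ := Nat.Partrec.Code.exists_code.1 hp.to_comp.partrec
  refine ⟨c, fun l k => ?_⟩
  simp [hc, foldl_ite_eq]

/-- The point mass at a constant sequence is computable: its cylinder probabilities are 0 or 1, so
the outputs 0 and `2 ^ k` are exact. -/
theorem nonempty_program (Z : Type u) [Nonempty Z] [Encodable Z] [MeasurableSpace Z]
    [DiscreteMeasurableSpace Z] : Nonempty (Program Z) := by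
  obtain ⟨z⟩ := ‹Nonempty Z›
  obtain ⟨c, hc⟩ := exists_code_constant (Encodable.encode z)
  refine ⟨⟨c, Measure.dirac fun _ => z, inferInstance, fun n x k =>
    ⟨if ∀ a ∈ (List.ofFn x).map Encodable.encode, a = Encodable.encode z then 2 ^ k else 0,
      ?_, ?_⟩⟩⟩
  · have h := hc ((List.ofFn x).map Encodable.encode) k
    rwa [Encodable.encode_prod_val, encode_map_encode, ← Encodable.encode_prod_val] at h
  · have hx : (∀ a ∈ (List.ofFn x).map Encodable.encode, a = Encodable.encode z) ↔
        (fun _ => z) ∈ cylinder x := by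
      simp [cylinder, List.mem_ofFn, eq_comm]
    rw [measureReal_def, Measure.dirac_apply' _ (measurableSet_cylinder x)]
    by_cases h : (fun _ => z) ∈ cylinder x
    · rw [if_pos (hx.2 h)]
      simp [h]
    · rw [if_neg (mt hx.1 h)]
      simp [h]

instance countable_program (Z : Type u) [Encodable Z] [MeasurableSpace Z] :
    Countable (Program Z) :=
  inferInstanceAs (Countable (Subtype _))

theorem exists_pmf_pos (α : Type*) [Nonempty α] [Countable α] :
    ∃ w : PMF α, ∀ a, 0 < w a := by
  obtain ⟨ε, hε, hsum⟩ := ENNReal.exists_pos_sum_of_countable one_ne_zero α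
  have h0 : ∑' a, (ε a : ENNReal) ≠ 0 := fun h => by
    obtain ⟨a⟩ := ‹Nonempty α›
    have := ENNReal.tsum_eq_zero.1 h a
    exact (hε a).ne' (by simpa using this)
  refine ⟨PMF.normalize _ h0 (hsum.trans ENNReal.one_lt_top).ne, fun a => ?_⟩
  rw [pos_iff_ne_zero, ← PMF.mem_support_iff, PMF.support_normalize]
  simpa using (hε a).ne'

variable {Z : Type u} [Encodable Z] [MeasurableSpace Z]

instance isProbabilityMeasure_law (θ : Program Z) : IsProbabilityMeasure θ.law :=
  θ.2.choose_spec.1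

instance isProbabilityMeasure_mixture (w : PMF (Program Z)) :
    IsProbabilityMeasure (mixture w) := by
  refine ⟨?_⟩
  simp [mixture, Measure.sum_apply _ MeasurableSet.univ, w.tsum_coe]

theorem mul_measureReal_law_le (w : PMF (Program Z)) (θ : Program Z) (s : Set (ℕ → Z)) :
    (w θ).toReal * θ.law.real s ≤ (mixture w).real s := by
  rw [measureReal_def, ← ENNReal.toReal_mul]
  refine ENNReal.toReal_mono (measure_ne_top _ _) ?_
  have := Measure.le_sum (fun θ => w θ • θ.law) θ s
  simpa [mixture] using this

end Programs

/-! ### Optimal policies and the tail bound -/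

section Policies

/-- Markov's inequality for `S²` at level `C² T / δ`. Covering by the good and bad events avoids
measurability of either. -/
theorem one_sub_le_measureReal_of_integral_sq_le {Ω : Type*}
    [MeasurableSpace Ω] (P : Measure Ω) [IsProbabilityMeasure P]
    {S : Ω → ℝ} {C : ℝ} (hC : 0 < C) {T : ℕ} (hT : 1 ≤ T)
    (hi : Integrable (fun ω => S ω ^ 2) P) (hS : ∫ ω, S ω ^ 2 ∂P ≤ C ^ 2 * T) {δ : ℝ}
    (hδ : 0 < δ) : 1 - δ ≤ P.real {ω | 1 / (T : ℝ) * S ω < C / √(T * δ)} := by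
  have hT' : (0 : ℝ) < T := by exact_mod_cast hT
  have hbad := mul_meas_ge_le_integral_of_nonneg
    (Filter.Eventually.of_forall fun ω => sq_nonneg (S ω)) hi (C ^ 2 * T / δ)
  have hb : P.real {ω | C ^ 2 * T / δ ≤ S ω ^ 2} ≤ δ := by
    have h1 := hbad.trans hS
    have h2 : 0 < C ^ 2 * T := by positivity
    rw [div_mul_eq_mul_div, div_le_iff₀ hδ] at h1
    exact le_of_mul_le_mul_left h1 h2
  have hcover : Set.univ ⊆ {ω | 1 / (T : ℝ) * S ω < C / √(T * δ)} ∪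
      {ω | C ^ 2 * T / δ ≤ S ω ^ 2} := by
    intro ω _
    by_cases h : 1 / (T : ℝ) * S ω < C / √(T * δ)
    · exact Or.inl h
    · right
      have hs : 0 < √(T * δ) := Real.sqrt_pos.2 (by positivity)
      have h1 : C / √(T * δ) * T ≤ S ω := by
        rw [not_lt, one_div_mul_eq_div, le_div_iff₀ hT'] at h
        exact h
      have h2 := pow_le_pow_left₀ (by positivity) h1 2
      refine le_trans (le_of_eq ?_) h2
      rw [mul_pow, div_pow, Real.sq_sqrt (by positivity)]
      field_simp
  have h1 := (measureReal_mono (μ := P) hcover).trans (measureReal_union_le _ _)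
  rw [probReal_univ] at h1
  linarith

variable {Z : Type u} {B : Type v} [Countable Z] [MeasurableSpace Z] [DiscreteMeasurableSpace Z]
  [MeasurableSpace B] {L : ℝ} {ℓ : B → Z → ℝ}

/-- There are only countably many histories of each length, so any choice of minimizers is
measurable. -/
theorem exists_isOptimalPolicy {Q : Measure (ℕ → Z)}
    (h : ∀ (n : ℕ) (x : Fin n → Z), ∃ a : B, IsOptimalPrediction Q ℓ x a) :
    ∃ b : (n : ℕ) → (Fin n → Z) → B, IsOptimalPolicy Q ℓ b := by
  choose b hb using h
  exact ⟨b, fun n => measurable_of_countable _, hb⟩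

theorem integral_nextLaw_sub (hℓ : IsLoss L ℓ) (R : Measure (ℕ → Z)) [IsFiniteMeasure R] {n : ℕ}
    (x : Fin n → Z) (a a' : B) :
    ∫ z, (ℓ a z - ℓ a' z) ∂nextLaw R x = condRisk R ℓ x a - condRisk R ℓ x a' := by
  have hi : ∀ a, Integrable (fun ω : ℕ → Z => ℓ a (ω n)) R[|cylinder x] := by
    intro a
    refine Integrable.of_bound
      ((measurable_of_countable (ℓ a)).comp (measurable_pi_apply n)).aestronglyMeasurable L
      (Filter.Eventually.of_forall fun ω => ?_)
    rw [Real.norm_of_nonneg (hℓ.nonneg _ _)]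
    exact hℓ.le _ _
  rw [← condMean_next R x (fun z => ℓ a z - ℓ a' z), condMean, condRisk, condRisk,
    integral_sub (hi a) (hi a')]

theorem one_sub_le_measureReal_avgRegret_lt (hℓ : IsLoss L ℓ) {P Q : Measure (ℕ → Z)}
    [IsProbabilityMeasure P] [IsProbabilityMeasure Q] {w : ℝ} (hw : 0 < w)
    (hPQ : ∀ s, w * P.real s ≤ Q.real s) {b b' : (n : ℕ) → (Fin n → Z) → B}
    (hb : IsOptimalPolicy Q ℓ b) (hb' : IsOptimalPolicy P ℓ b') {C : ℝ} (hC : 0 < C)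
    (hCL : 8 * L ^ 2 * (1 - Real.log w) ≤ C ^ 2) {T : ℕ} (hT : 1 ≤ T) {δ : ℝ} (hδ : 0 < δ) :
    1 - δ ≤ P.real {ω | avgRegret ℓ b b' T ω < C / √(T * δ)} := by
  let d : (n : ℕ) → (Fin n → Z) → Z → ℝ := fun n x z => ℓ (b n x) z - ℓ (b' n x) z
  have hd : ∀ n x z, |d n x z| ≤ L := fun n x z => by
    have h1 := hℓ.nonneg (b n x) z
    have h2 := hℓ.nonneg (b' n x) z
    have h3 := hℓ.le (b n x) z
    have h4 := hℓ.le (b' n x) z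
    rw [abs_le]
    constructor <;> simp only [d] <;> linarith
  -- `0 ≤ L` is not part of `IsLoss`; it follows once some outcome exists.
  obtain ⟨ω₀⟩ : Nonempty (ℕ → Z) := nonempty_of_isProbabilityMeasure P
  have hL : 0 ≤ L := (abs_nonneg _).trans (hd 0 (initial 0 ω₀) (ω₀ 0))
  refine one_sub_le_measureReal_of_integral_sq_le P hC hT
    (S := fun ω => ∑ n ∈ Finset.range T, d n (initial n ω) (ω n)) ?_ ?_ hδ
  · refine integrable_of_abs_le (K := (T * L) ^ 2)
      ((Finset.measurable_sum _ fun n _ => measurable_comp_initial_next (d n)).pow_const 2)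
      fun ω => ?_
    rw [abs_pow]
    refine pow_le_pow_left₀ (abs_nonneg _) ?_ 2
    refine (Finset.abs_sum_le_sum_abs _ _).trans ?_
    exact (Finset.sum_le_sum fun n _ => hd n _ _).trans (by simp)
  · refine (integral_sq_sum_le hL hd (fun n x => ?_) (fun n x => ?_) hw hPQ T).trans (by gcongr)
    · rw [integral_nextLaw_sub hℓ]
      exact sub_nonneg.2 (hb'.optimal n x _)
    · rw [integral_nextLaw_sub hℓ]
      exact sub_nonpos.2 (hb.optimal n x _)

end Policies

end UniversalPrediction

theorem theorem2 {Z : Type u} [Nonempty Z] [Encodable Z] [MeasurableSpace Z]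
    [DiscreteMeasurableSpace Z] :
    (∃ w : PMF (Program Z), ∀ θ, 0 < w θ) ∧
    ∀ w : PMF (Program Z), (∀ θ, 0 < w θ) →
      IsProbabilityMeasure (mixture w) ∧
      ∃ C : Measure (ℕ → Z) → ℝ → ℝ,
        ∀ (B : Type v) [MeasurableSpace B] (L : ℝ) (ℓ : B → Z → ℝ), IsLoss L ℓ →
          ((∀ (n : ℕ) (x : Fin n → Z), ∃ a : B, IsOptimalPrediction (mixture w) ℓ x a) →
            ∃ b : (n : ℕ) → (Fin n → Z) → B, IsOptimalPolicy (mixture w) ℓ b) ∧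
          ∀ b : (n : ℕ) → (Fin n → Z) → B, IsOptimalPolicy (mixture w) ℓ b →
            ∀ P : Measure (ℕ → Z), IsProbabilityMeasure P → IsComputable P →
              ∀ b' : (n : ℕ) → (Fin n → Z) → B, IsOptimalPolicy P ℓ b' →
                ∀ T : ℕ, 1 ≤ T → ∀ δ ∈ Set.Ioo (0 : ℝ) 1,
                  1 - δ ≤ P.real {ω | avgRegret ℓ b b' T ω < C P L / Real.sqrt (T * δ)} := by
  have := nonempty_program Z
  refine ⟨exists_pmf_pos _, fun w hw => ⟨inferInstance, ?_⟩⟩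
  -- The constant is fixed before the prediction problem and the policies. Stating its properties
  -- conditionally lets `choose` produce a total function.
  have hC : ∀ (P : Measure (ℕ → Z)) (L : ℝ), ∃ C : ℝ, IsProbabilityMeasure P → IsComputable P →
      0 < C ∧ ∃ θ : Program Z, θ.law = P ∧
        8 * L ^ 2 * (1 - Real.log (w θ).toReal) ≤ C ^ 2 := by
    intro P L
    by_cases h : IsProbabilityMeasure P ∧ IsComputable P
    · obtain ⟨hP, c, hc⟩ := h
      let θ : Program Z := ⟨c, P, hP, hc⟩
      -- The summand 1 keeps the constant positive when `L = 0`, as the strict inequality requires.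
      refine ⟨√(8 * L ^ 2 * (1 - Real.log (w θ).toReal)) + 1, fun _ _ => ⟨by positivity, θ,
        θ.law_eq P hc, ?_⟩⟩
      have h1 := (le_max_left _ _).trans_eq
        (Real.sq_sqrt' (x := 8 * L ^ 2 * (1 - Real.log (w θ).toReal))).symm
      nlinarith [Real.sqrt_nonneg (8 * L ^ 2 * (1 - Real.log (w θ).toReal))]
    · exact ⟨0, fun h1 h2 => absurd ⟨h1, h2⟩ h⟩
  choose C hC using hC
  refine ⟨C, fun B _ L ℓ hℓ => ⟨exists_isOptimalPolicy, ?_⟩⟩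
  intro b hb P hP hPc b' hb' T hT δ hδ
  obtain ⟨hpos, θ, rfl, hle⟩ := hC P L hP hPc
  exact one_sub_le_measureReal_avgRegret_lt hℓ
    (ENNReal.toReal_pos (hw θ).ne' (w.apply_ne_top θ)) (mul_measureReal_law_le w θ) hb hb' hpos
    hle hT hδ.1
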